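/- Let $\mathbb{K}$ be a field, let $s\ge 1$ be an integer and let $t_1,\dots,t_s$ be positive integers. Let $G=G(t_1,\dots,t_s)$ be the finite simple graph that consists of $s$ odd cycles of lengths $2t_1+1,\dots,2t_s+1$, all sharing one common vertex and otherwise pairwise disjoint. Let $\mathbb{K}[G]=\mathbb{K}[e : e\in E(G)]/I_G$ be its toric edge ring, where $I_G$ is the kernel of the $\mathbb{K}$-algebra homomorphism $\mathbb{K}[e : e\in E(G)]\to\mathbb{K}[x_v : v\in V(G)]$ sending the variable of an edge $e=\{v,w\}$ to $x_vx_w$; the polynomial ring $\mathbb{K}[e : e\in E(G)]$ has the standard grading, and $I_G$ is homogeneous. The $h$-polynomial of $\mathbb{K}[G]$ is the unique polynomial $h(\mathbb{K}[G];z)\in\mathbb{Z}[z]$ with $h(\mathbb{K}[G];1)\ne 0$ and $$\sum_{n\ge 0}\dim_{\mathbb{K}}(\mathbb{K}[G]_n)\,z^n=\frac{h(\mathbb{K}[G];z)}{(1-z)^{d}},$$ where $d=\dim \mathbb{K}[G]$ is the Krull dimension. Then $$h(\mathbb{K}[G];z)=\prod_{i=1}^{s}\left(1+z+z^2+\cdots+z^{t_i}\right)-z\prod_{i=1}^{s}\left(1+z+z^2+\cdots+z^{t_i-1}\right).$$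 -/

import Mathlib

/-- The inclusion of the `i`-th cycle, with vertex set `Fin (2 * t i + 1)`, into the vertex set of
`G(t_1, …, t_s)`. The vertex `0` of every cycle is sent to the common vertex `none`; the vertex
`j + 1` of the `i`-th cycle is sent to `some ⟨i, j⟩`. -/
def cycleVertex {s : ℕ} (t : Fin s → ℕ) (i : Fin s) :
    Fin (2 * t i + 1) → Option (Σ i : Fin s, Fin (2 * t i)) :=
  Fin.cases none fun j => some ⟨i, j⟩

/-- The graph `G(t_1, …, t_s)`: the union of `s` cycles of lengths `2 * t_i + 1`, glued along
a single common vertex. -/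
def oddCycleGraph {s : ℕ} (t : Fin s → ℕ) :
    SimpleGraph (Option (Σ i : Fin s, Fin (2 * t i))) :=
  ⨆ i : Fin s, (SimpleGraph.cycleGraph (2 * t i + 1)).map (cycleVertex t i)

/-- The `K`-algebra homomorphism `K[e | e ∈ E(G)] → K[x_v | v ∈ V(G)]` which sends the variable
of an edge `{v, w}` to `x_v * x_w`. -/
noncomputable def edgeMap (K : Type*) [Field K] {V : Type*} (G : SimpleGraph V) :
    MvPolynomial G.edgeSet K →ₐ[K] MvPolynomial V K :=
  MvPolynomial.aeval fun e => ((e : Sym2 V).map MvPolynomial.X).mul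

/-- The toric ideal `I_G` of a graph. -/
noncomputable def toricIdeal (K : Type*) [Field K] {V : Type*} (G : SimpleGraph V) :
    Ideal (MvPolynomial G.edgeSet K) :=
  RingHom.ker (edgeMap K G)

/-- The degree `n` piece `(R / I)_n` of `R / I`, where `R = K[x_i | i ∈ σ]` carries the standard
grading and `I` is a homogeneous ideal: the image of the degree `n` piece of `R`. -/
noncomputable def quotientPiece {K : Type*} [Field K] {σ : Type*}
    (I : Ideal (MvPolynomial σ K)) (n : ℕ) : Submodule K (MvPolynomial σ K ⧸ I) :=
  (MvPolynomial.homogeneousSubmodule σ K n).map (Ideal.Quotient.mkₐ K I).toLinearMap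

/-- The Hilbert series `∑ dim_K (R / I)_n z^n` of `R / I` (for finite `σ`). -/
noncomputable def hilbertSeries {K : Type*} [Field K] {σ : Type*}
    (I : Ideal (MvPolynomial σ K)) : PowerSeries ℤ :=
  PowerSeries.mk fun n => (Module.finrank K (quotientPiece I n) : ℤ)

section

attribute [local instance] MvPolynomial.gradedAlgebra

/-- `h` is the `h`-polynomial of `R / I`: the ideal `I` is homogeneous, `h(1) ≠ 0`, and the
Hilbert series of `R / I` is `h(z) / (1 - z) ^ d`, where `d` is the Krull dimension of `R / I`. -/
def IsHPolynomial {K : Type*} [Field K] {σ : Type*}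
    (I : Ideal (MvPolynomial σ K)) (h : Polynomial ℤ) : Prop :=
  I.IsHomogeneous (MvPolynomial.homogeneousSubmodule σ K) ∧
    h.eval 1 ≠ 0 ∧
    ∃ d : ℕ, ringKrullDim (MvPolynomial σ K ⧸ I) = d ∧
      hilbertSeries I * (1 - PowerSeries.X) ^ d = (h : PowerSeries ℤ)

end

/-- There is at most one `h`-polynomial. -/
theorem IsHPolynomial.unique {K : Type*} [Field K] {σ : Type*}
    {I : Ideal (MvPolynomial σ K)} {h h' : Polynomial ℤ}
    (H : IsHPolynomial I h) (H' : IsHPolynomial I h') : h = h' := by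
  obtain ⟨-, -, d, hd, e⟩ := H
  obtain ⟨-, -, d', hd', e'⟩ := H'
  have : d = d' := by
    rw [hd] at hd'
    exact_mod_cast hd'
  subst this
  exact Polynomial.coe_injective ℤ (e.symm.trans e')

/-! The ring `K[G]` has as basis the monomials `x^β` with `β` in the image of the monoid map `φ`
sending an edge vector to the sum of its edges' endpoints, so the Hilbert series counts the images
`S n` of the edge vectors of degree `n`. On cycle `i`, let `P i` be the `t i + 1` edges at even
positions and `Q i` the `t i` edges at odd positions. Then `φ (P i) = φ (Q i) + c`, where `c` is
twice the common vertex and does not depend on `i`.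

Two vectors with equal image differ by an alternating vector on each cycle, with coefficients of sum
zero. Hence (`exists_le_of_linearCombination_eq`) `φ` is injective on the vectors containing no `P
i`, and on those containing no `Q i`. The images of the former are the elements of `S (n + 1)`
outside `S n + c`; those of the latter are the `β` in `S n` with `β + c` outside `S (n + 1)`.
Comparing cardinalities (`mk_ncard_image_mul_one_sub_X`) gives `(1 - z) H(z) = A_P(z) - z A_Q(z)`.
The supports are disjoint, so the avoidance series are `∏ (1 - z ^ (t i + 1)) / (1 - z) ^ |E|` and
`∏ (1 - z ^ t i) / (1 - z) ^ |E|`.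

The Krull dimension is `|V|`, because an odd cycle makes every `x_v` algebraic over `K[G]`. As `|E|
+ 1 = |V| + s`, cancelling `(1 - z) ^ s` leaves the stated polynomial. -/

/-! ### Counting exponent vectors that avoid squarefree monomials -/

/-- The generating function, by degree, of a set of exponent vectors. -/
noncomputable def degreeSeries {ι : Type*} (S : Set (ι →₀ ℕ)) : PowerSeries ℤ :=
  PowerSeries.mk fun n => ({m | m ∈ S ∧ m.degree = n}.ncard : ℤ)

/-- The exponent vectors which are divisible by none of the squarefree monomials
`∏ e ∈ T k, X e` with `k ∈ F`. -/
def avoiding {ι κ : Type*} (T : κ → Finset ι) (F : Finset κ) : Set (ι →₀ ℕ) :=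
  {m | ∀ k ∈ F, ∃ e ∈ T k, m e = 0}

/-- The exponent vector of the squarefree monomial with support `T`. -/
noncomputable def indicatorVector {ι : Type*} (T : Finset ι) : ι →₀ ℕ := ∑ e ∈ T, Finsupp.single e 1

lemma degree_indicatorVector {ι : Type*} (T : Finset ι) : (indicatorVector T).degree = T.card := by
  simp [indicatorVector]

lemma indicatorVector_apply {ι : Type*} [DecidableEq ι] (T : Finset ι) (e : ι) :
    indicatorVector T e = if e ∈ T then 1 else 0 := by
  simp [indicatorVector, Finsupp.finsetSum_apply, Finsupp.single_apply]

lemma indicatorVector_le_iff {ι : Type*} (T : Finset ι) (m : ι →₀ ℕ) :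
    indicatorVector T ≤ m ↔ ∀ e ∈ T, m e ≠ 0 := by
  classical
  simp only [Finsupp.le_def, indicatorVector_apply]
  refine forall_congr' fun e => ?_
  split_ifs with h <;> simp [h, Nat.one_le_iff_ne_zero]

lemma finite_degree_eq (ι : Type*) [Finite ι] (n : ℕ) : {m : ι →₀ ℕ | m.degree = n}.Finite := by
  have := Fintype.ofFinite ι
  classical
  refine (Finset.finite_toSet (Finset.finsuppAntidiag Finset.univ n)).subset fun m hm => ?_
  simp only [Set.mem_ofPred_eq, Finsupp.degree_eq_sum] at hm
  simp [hm]

/-- The vectors lost by also avoiding `T k` are the translates by `indicatorVector (T k)` of those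
avoiding `F`: by disjointness, the translation does not affect the other supports. -/
lemma degreeSeries_avoiding_insert {ι κ : Type*} [Finite ι] [DecidableEq κ] {T : κ → Finset ι}
    (hT : Pairwise fun k l => Disjoint (T k) (T l)) {F : Finset κ} {k : κ} (hk : k ∉ F) :
    degreeSeries (avoiding T (insert k F)) =
      degreeSeries (avoiding T F) * (1 - PowerSeries.X ^ (T k).card) := by
  classical
  ext n
  rw [mul_sub, mul_one, map_sub, PowerSeries.coeff_mul_X_pow']
  simp only [degreeSeries, PowerSeries.coeff_mk]
  have hsplit : {m | m ∈ avoiding T F ∧ m.degree = n} =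
      {m | m ∈ avoiding T (insert k F) ∧ m.degree = n} ∪
        {m | (m ∈ avoiding T F ∧ indicatorVector (T k) ≤ m) ∧ m.degree = n} := by
    ext m
    simp only [avoiding, indicatorVector_le_iff, Set.mem_ofPred_eq, Set.mem_union,
      Finset.mem_insert, forall_eq_or_imp]
    have h : (∀ e ∈ T k, m e ≠ 0) ↔ ¬ ∃ e ∈ T k, m e = 0 := by push Not; rfl
    rw [h]
    by_cases h' : ∃ e ∈ T k, m e = 0 <;> simp only [h', true_and, false_and, and_true, and_false,
      not_true, not_false_eq_true, or_false, false_or]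
  have hdisj : Disjoint {m | m ∈ avoiding T (insert k F) ∧ m.degree = n}
      {m | (m ∈ avoiding T F ∧ indicatorVector (T k) ≤ m) ∧ m.degree = n} := by
    rw [Set.disjoint_left]
    rintro m ⟨h, -⟩ ⟨⟨-, h'⟩, -⟩
    obtain ⟨e, he, h0⟩ := h k (Finset.mem_insert_self _ _)
    exact (indicatorVector_le_iff _ _).1 h' e he h0
  have hfin := finite_degree_eq ι n
  rw [hsplit, Set.ncard_union_eq hdisj (hfin.subset fun m hm => hm.2)
    (hfin.subset fun m hm => hm.2)]
  have hshift : (if (T k).card ≤ n then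
      ({m | m ∈ avoiding T F ∧ m.degree = n - (T k).card}.ncard : ℤ) else 0) =
      {m | (m ∈ avoiding T F ∧ indicatorVector (T k) ≤ m) ∧ m.degree = n}.ncard := by
    split_ifs with h
    · norm_cast
      rw [← Set.ncard_image_of_injective _ (add_left_injective (indicatorVector (T k)))]
      congr 1
      have key : ∀ m : ι →₀ ℕ, m + indicatorVector (T k) ∈ avoiding T F ↔ m ∈ avoiding T F := by
        intro m
        refine forall₂_congr fun l hl => exists_congr fun e => and_congr_right fun he => ?_
        have hne : l ≠ k := fun h => hk (h ▸ hl)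
        have : e ∉ T k := Finset.disjoint_left.1 (hT hne) he
        simp [indicatorVector_apply, this]
      ext m
      simp only [Set.mem_image, Set.mem_ofPred_eq]
      constructor
      · rintro ⟨m', ⟨h1, h2⟩, rfl⟩
        refine ⟨⟨(key _).2 h1, le_add_self⟩, ?_⟩
        rw [map_add, h2, degree_indicatorVector, Nat.sub_add_cancel h]
      · rintro ⟨⟨h1, h2⟩, h3⟩
        obtain ⟨m', rfl⟩ := exists_add_of_le h2
        rw [add_comm] at h1 h3 ⊢
        refine ⟨m', ⟨(key _).1 h1, ?_⟩, rfl⟩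
        rw [← h3, map_add, degree_indicatorVector, Nat.add_sub_cancel]
    · symm
      norm_cast
      convert Set.ncard_empty (ι →₀ ℕ)
      rw [Set.eq_empty_iff_forall_notMem]
      rintro m ⟨⟨-, h1⟩, h2⟩
      obtain ⟨m', rfl⟩ := exists_add_of_le h1
      rw [map_add, degree_indicatorVector] at h2
      omega
  rw [hshift]
  push_cast
  ring

lemma degreeSeries_avoiding {ι κ : Type*} [Finite ι] {T : κ → Finset ι}
    (hT : Pairwise fun k l => Disjoint (T k) (T l)) (F : Finset κ) :
    degreeSeries (avoiding T F) =
      degreeSeries (Set.univ : Set (ι →₀ ℕ)) * ∏ k ∈ F, (1 - PowerSeries.X ^ (T k).card) := by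
  classical
  induction F using Finset.induction_on with
  | empty => simp [avoiding]
  | insert k F hk ih =>
    rw [degreeSeries_avoiding_insert hT hk, ih, Finset.prod_insert hk]
    ring

lemma degreeSeries_univ_mul (ι : Type*) [Fintype ι] :
    degreeSeries (Set.univ : Set (ι →₀ ℕ)) * (1 - PowerSeries.X) ^ Fintype.card ι = 1 := by
  classical
  -- Avoiding every single variable leaves only the zero vector, whose series is `1`.
  have h := degreeSeries_avoiding (T := fun e : ι => {e})
    (fun k l hkl => Finset.disjoint_singleton.2 hkl) Finset.univ
  simp only [Finset.card_singleton, pow_one, Finset.prod_const, Finset.card_univ] at h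
  rw [← h]
  ext n
  have : {m : ι →₀ ℕ | m ∈ avoiding (fun e : ι => {e}) Finset.univ ∧ m.degree = n} =
      {m | m = 0 ∧ n = 0} := by
    ext m
    have : m ∈ avoiding (fun e : ι => {e}) Finset.univ ↔ m = 0 := by
      simp [avoiding, Finsupp.ext_iff]
    simp only [Set.mem_ofPred_eq, this]
    refine and_congr_right fun h => ?_
    rw [h, map_zero, eq_comm]
  rw [degreeSeries, PowerSeries.coeff_mk, this, PowerSeries.coeff_one]
  split_ifs with hn <;> simp [hn]

/-! ### Counting the image of a monoid map -/

/-- Translation by `c` matches the part of degree `n` that stays in the image with the part of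
degree `n + 1` that comes from it. The two complements are parametrized injectively by the vectors
avoiding all `Q k` and all `P k` respectively. -/
lemma mk_ncard_image_mul_one_sub_X {ι κ V : Type*} [Finite ι] [Fintype κ]
    (φ : (ι →₀ ℕ) →+ (V →₀ ℕ)) (c : V →₀ ℕ) (P Q : κ → Finset ι)
    (hcard : ∀ k, (P k).card = (Q k).card + 1)
    (hφ : ∀ k, φ (indicatorVector (P k)) = φ (indicatorVector (Q k)) + c)
    (hP : ∀ m m', φ m = φ m' → m ≠ m' → ∃ k, indicatorVector (P k) ≤ m)
    (hQ : ∀ m m', φ m = φ m' → m ≠ m' → ∃ k, indicatorVector (Q k) ≤ m)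
    (hc : ∀ m m', φ m = φ m' + c →
      (∃ k, indicatorVector (P k) ≤ m) ∧ ∃ k, indicatorVector (Q k) ≤ m') :
    PowerSeries.mk (fun n => ((φ '' {m | m.degree = n}).ncard : ℤ)) * (1 - PowerSeries.X) =
      degreeSeries (avoiding P Finset.univ) -
        PowerSeries.X * degreeSeries (avoiding Q Finset.univ) := by
  classical
  have hav : ∀ (T : κ → Finset ι) m, m ∈ avoiding T Finset.univ ↔
      ¬ ∃ k, indicatorVector (T k) ≤ m := by
    intro T m
    simp [avoiding, indicatorVector_le_iff]
  have hinj : ∀ (T : κ → Finset ι),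
      (∀ m m', φ m = φ m' → m ≠ m' → ∃ k, indicatorVector (T k) ≤ m) → ∀ n,
      (φ '' {m | m ∈ avoiding T Finset.univ ∧ m.degree = n}).ncard =
        {m | m ∈ avoiding T Finset.univ ∧ m.degree = n}.ncard := by
    intro T hT n
    refine Set.InjOn.ncard_image fun m hm m' _ h => ?_
    by_contra hne
    exact (hav T m).1 hm.1 (hT m m' h hne)
  have hfin : ∀ n (A : Set (V →₀ ℕ)), A ⊆ φ '' {m | m.degree = n} → A.Finite := fun n A hA =>
    ((finite_degree_eq ι n).image φ).subset hA
  ext n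
  rw [mul_sub, mul_one, map_sub, map_sub]
  cases n with
  | zero =>
    simp only [PowerSeries.coeff_mk, PowerSeries.coeff_zero_mul_X, PowerSeries.coeff_zero_X_mul,
      sub_zero, degreeSeries]
    rw [← hinj P hP]
    congr 3
    ext m
    simp only [Set.mem_ofPred_eq, Finsupp.degree_eq_zero_iff, iff_and_self]
    rintro rfl
    rw [hav]
    -- The zero vector avoids every `P k`, since `P k` is nonempty.
    rintro ⟨k, hk⟩
    have h0 := degree_indicatorVector (P k)
    rw [le_zero_iff.1 hk, map_zero, hcard] at h0
    omega
  | succ n =>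
    simp only [PowerSeries.coeff_mk, PowerSeries.coeff_succ_mul_X, PowerSeries.coeff_succ_X_mul,
      degreeSeries]
    set U : Set (V →₀ ℕ) := {β | β ∈ φ '' {m | m.degree = n} ∧ β + c ∈ φ '' {m | m.degree = n + 1}}
    have h1 : φ '' {m | m.degree = n + 1} =
        (· + c) '' U ∪ φ '' {m | m ∈ avoiding P Finset.univ ∧ m.degree = n + 1} := by
      apply Set.Subset.antisymm
      · rintro _ ⟨m, hm, rfl⟩
        by_cases h : ∃ k, indicatorVector (P k) ≤ m
        · left
          obtain ⟨k, hk⟩ := h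
          obtain ⟨m', rfl⟩ := exists_add_of_le hk
          rw [Set.mem_ofPred_eq, map_add, degree_indicatorVector, hcard] at hm
          -- Trading `P k` for `Q k` lowers the degree by one and subtracts `c` from the image.
          have e : φ (indicatorVector (Q k) + m') + c = φ (indicatorVector (P k) + m') := by
            rw [map_add, map_add, hφ]; abel
          refine ⟨φ (indicatorVector (Q k) + m'), ⟨⟨_, ?_, rfl⟩, ⟨_, ?_, e.symm⟩⟩, e⟩
          · rw [Set.mem_ofPred_eq, map_add, degree_indicatorVector]; omega
          · rw [Set.mem_ofPred_eq, map_add, degree_indicatorVector, hcard]; omega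
        · exact Or.inr ⟨m, ⟨(hav P m).2 h, hm⟩, rfl⟩
      · rintro _ (⟨β, hβ, rfl⟩ | ⟨m, hm, rfl⟩)
        · exact hβ.2
        · exact ⟨m, hm.2, rfl⟩
    have h2 : φ '' {m | m.degree = n} =
        U ∪ φ '' {m | m ∈ avoiding Q Finset.univ ∧ m.degree = n} := by
      apply Set.Subset.antisymm
      · rintro _ ⟨m, hm, rfl⟩
        by_cases h : ∃ k, indicatorVector (Q k) ≤ m
        · left
          refine ⟨⟨m, hm, rfl⟩, ?_⟩
          obtain ⟨k, hk⟩ := h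
          obtain ⟨m', rfl⟩ := exists_add_of_le hk
          rw [Set.mem_ofPred_eq, map_add, degree_indicatorVector] at hm
          refine ⟨indicatorVector (P k) + m', ?_, ?_⟩
          · rw [Set.mem_ofPred_eq, map_add, degree_indicatorVector, hcard]; omega
          · rw [map_add, map_add, hφ]; abel
        · exact Or.inr ⟨m, ⟨(hav Q m).2 h, hm⟩, rfl⟩
      · rintro _ (hβ | ⟨m, hm, rfl⟩)
        · exact hβ.1
        · exact ⟨m, hm.2, rfl⟩
    have d1 : Disjoint ((· + c) '' U)
        (φ '' {m | m ∈ avoiding P Finset.univ ∧ m.degree = n + 1}) := by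
      rw [Set.disjoint_left]
      rintro _ ⟨_, ⟨⟨m', -, rfl⟩, -⟩, rfl⟩ ⟨m, hm, h⟩
      exact (hav P m).1 hm.1 (hc m m' h).1
    have d2 : Disjoint U (φ '' {m | m ∈ avoiding Q Finset.univ ∧ m.degree = n}) := by
      rw [Set.disjoint_left]
      rintro _ ⟨-, ⟨m, -, h⟩⟩ ⟨m', hm', rfl⟩
      exact (hav Q m').1 hm'.1 (hc m m' h).2
    have c1 := Set.ncard_union_eq d1 (hfin (n + 1) _ (h1 ▸ Set.subset_union_left))
      (hfin (n + 1) _ (h1 ▸ Set.subset_union_right))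
    have c2 := Set.ncard_union_eq d2 (hfin n _ (h2 ▸ Set.subset_union_left))
      (hfin n _ (h2 ▸ Set.subset_union_right))
    rw [← h1, hinj P hP, Set.ncard_image_of_injective _ (add_left_injective c)] at c1
    rw [← h2, hinj Q hQ] at c2
    rw [c1, c2]
    push_cast
    ring

/-! ### Homogeneity and Hilbert function of a kernel -/

open MvPolynomial in
-- Since `f` multiplies degrees by `k ≠ 0`, it sends the component of degree `i` to the component of
-- degree `k * i` of the image.
lemma isHomogeneous_ker {K σ τ : Type*} [Field K]
    (f : MvPolynomial σ K →ₐ[K] MvPolynomial τ K) {k : ℕ} (hk : k ≠ 0)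
    (hf : ∀ n p, IsHomogeneous p n → IsHomogeneous (f p) (k * n)) :
    letI := MvPolynomial.gradedAlgebra (σ := σ) (R := K)
    Ideal.IsHomogeneous (homogeneousSubmodule σ K) (RingHom.ker f) := by
  intro i p hp
  rw [RingHom.mem_ker] at hp ⊢
  change f (decomposition.decompose' p i) = 0
  rw [decomposition.decompose'_apply]
  have h1 : homogeneousComponent (k * i) (f p) = f (homogeneousComponent i p) := by
    conv_lhs => rw [← sum_homogeneousComponent p]
    rw [map_sum, map_sum, Finset.sum_eq_single i]
    · rw [homogeneousComponent_of_mem (hf i _ (homogeneousComponent_isHomogeneous i p)), if_pos rfl]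
    · intro j _ hj
      rw [homogeneousComponent_of_mem (hf j _ (homogeneousComponent_isHomogeneous j p)), if_neg]
      simpa [hk] using Ne.symm hj
    · intro hi
      rw [homogeneousComponent_eq_zero i p (by simpa using hi), map_zero, map_zero]
  rw [← h1, hp, map_zero]

lemma finrank_quotientPiece_ker {K σ τ : Type*} [Field K]
    (f : MvPolynomial σ K →ₐ[K] MvPolynomial τ K) (n : ℕ) :
    Module.finrank K (quotientPiece (RingHom.ker f) n) =
      Module.finrank K ((MvPolynomial.homogeneousSubmodule σ K n).map f.toLinearMap) := by
  have hg : Function.Injective (Ideal.kerLiftAlg f).toLinearMap := Ideal.kerLiftAlg_injective f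
  rw [LinearEquiv.finrank_eq (Submodule.equivMapOfInjective _ hg (quotientPiece _ n)),
    quotientPiece, ← Submodule.map_comp]
  rfl

lemma map_rename_homogeneousSubmodule {K σ τ : Type*} [Field K] {π : σ → τ}
    (hπ : Function.Surjective π) (n : ℕ) :
    (MvPolynomial.homogeneousSubmodule σ K n).map (MvPolynomial.rename π).toLinearMap =
      MvPolynomial.homogeneousSubmodule τ K n := by
  apply le_antisymm
  · rintro _ ⟨p, hp, rfl⟩
    exact MvPolynomial.IsHomogeneous.rename_isHomogeneous hp
  · intro p hp
    obtain ⟨g, hg⟩ := hπ.hasRightInverse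
    refine ⟨MvPolynomial.rename g p, MvPolynomial.IsHomogeneous.rename_isHomogeneous hp, ?_⟩
    simp [MvPolynomial.rename_rename, hg.comp_eq_id]

lemma aeval_monomial_monomial {K σ τ : Type*} [Field K] (w : σ → τ →₀ ℕ) (m : σ →₀ ℕ) :
    MvPolynomial.aeval (fun e => MvPolynomial.monomial (w e) (1 : K))
      (MvPolynomial.monomial m (1 : K)) =
      MvPolynomial.monomial (Finsupp.linearCombination ℕ w m) 1 := by
  rw [MvPolynomial.aeval_monomial, map_one, one_mul, Finsupp.linearCombination_apply,
    Finsupp.sum, Finsupp.prod, MvPolynomial.monomial_sum_one]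
  simp [MvPolynomial.monomial_pow]

/-- Monomials go to monomials, and distinct monomials are linearly independent. -/
lemma finrank_map_aeval_monomial {K σ τ : Type*} [Field K] [Finite σ] (w : σ → τ →₀ ℕ) (n : ℕ) :
    Module.finrank K ((MvPolynomial.homogeneousSubmodule σ K n).map
      (MvPolynomial.aeval fun e => MvPolynomial.monomial (w e) (1 : K)).toLinearMap) =
      (Finsupp.linearCombination ℕ w '' {m | m.degree = n}).ncard := by
  have h1 : MvPolynomial.homogeneousSubmodule σ K n =
      Submodule.span K ((fun m => MvPolynomial.monomial m (1 : K)) '' {m | m.degree = n}) := by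
    apply le_antisymm
    · intro p hp
      rw [p.as_sum]
      refine Submodule.sum_mem _ fun m hm => ?_
      rw [← mul_one (p.coeff m), ← smul_eq_mul, ← MvPolynomial.smul_monomial]
      refine Submodule.smul_mem _ _ (Submodule.subset_span ⟨m, ?_, rfl⟩)
      by_contra hne
      exact MvPolynomial.mem_support_iff.1 hm
        (MvPolynomial.IsHomogeneous.coeff_eq_zero hp hne)
    · rw [Submodule.span_le]
      rintro _ ⟨m, hm, rfl⟩
      exact MvPolynomial.isHomogeneous_monomial 1 hm
  have hfin : (Finsupp.linearCombination ℕ w '' {m : σ →₀ ℕ | m.degree = n}).Finite :=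
    (finite_degree_eq σ n).image _
  have := hfin.fintype
  set f : MvPolynomial σ K →ₐ[K] MvPolynomial τ K :=
    MvPolynomial.aeval fun e => MvPolynomial.monomial (w e) (1 : K) with hf
  have hfm : ∀ m, f (MvPolynomial.monomial m 1) =
      MvPolynomial.monomial (Finsupp.linearCombination ℕ w m) 1 := aeval_monomial_monomial w
  rw [h1, Submodule.map_span, ← Set.image_comp]
  have h2 : (⇑f.toLinearMap ∘ fun m => MvPolynomial.monomial m (1 : K)) '' {m | m.degree = n} =
      Set.range fun a : Finsupp.linearCombination ℕ w '' {m : σ →₀ ℕ | m.degree = n} =>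
        MvPolynomial.monomial (a : τ →₀ ℕ) (1 : K) := by
    ext p
    simp only [Set.mem_image, Set.mem_range, Subtype.exists, Function.comp_apply,
      AlgHom.toLinearMap_apply, hfm]
    constructor
    · rintro ⟨m, hm, rfl⟩
      exact ⟨_, ⟨m, hm, rfl⟩, rfl⟩
    · rintro ⟨_, ⟨m, hm, rfl⟩, rfl⟩
      exact ⟨m, hm, rfl⟩
  rw [h2, finrank_span_eq_card, Set.ncard_eq_toFinset_card', Set.toFinset_card]
  have := (MvPolynomial.basisMonomials τ K).linearIndependent
  rw [MvPolynomial.coe_basisMonomials] at this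
  exact this.comp _ Subtype.val_injective

/-! ### Krull dimension via transcendence degree -/

/-- Incomparability gives `≤`; lying over and going up give `≥`. -/
lemma ringKrullDim_eq_of_isIntegral (A B : Type*) [CommRing A] [CommRing B] [Algebra A B]
    [Algebra.IsIntegral A B] (hinj : Function.Injective (algebraMap A B)) :
    ringKrullDim B = ringKrullDim A := by
  apply le_antisymm
  · refine Order.krullDim_le_of_strictMono (PrimeSpectrum.comap (algebraMap A B)) ?_
    intro p q hpq
    exact Ideal.IsIntegral.comap_lt_comap (R := A) (I := p.asIdeal) (J := q.asIdeal) hpq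
  · refine iSup_le fun l => ?_
    have : FaithfulSMul A B := (faithfulSMul_iff_algebraMap_injective A B).2 hinj
    obtain ⟨P, hP, hlo⟩ := Ideal.nonempty_primesOver (S := B) l.head.asIdeal
    obtain ⟨L, hL, -⟩ := Ideal.exists_ltSeries_of_hasGoingUp l P
    rw [← hL]
    exact Order.LTSeries.length_le_krullDim L

/-- Noether normalization makes `B` integral over a polynomial ring, which has the same dimension
and transcendence degree. -/
lemma ringKrullDim_eq_of_trdeg {K B : Type*} [Field K] [CommRing B] [IsDomain B] [Algebra K B]
    [Algebra.FiniteType K B] {n : ℕ} (h : Algebra.trdeg K B = n) : ringKrullDim B = n := by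
  obtain ⟨d, g, hg, hint⟩ := exists_integral_inj_algHom_of_fg K B
  algebraize [g.toRingHom]
  have hd : ringKrullDim B = d := by
    rw [ringKrullDim_eq_of_isIntegral (MvPolynomial (Fin d) K) B hg]
    simp
  have : IsScalarTower K (MvPolynomial (Fin d) K) B :=
    IsScalarTower.of_algebraMap_eq fun x => (g.commutes x).symm
  have : FaithfulSMul (MvPolynomial (Fin d) K) B :=
    (faithfulSMul_iff_algebraMap_injective _ B).2 hg
  have key := lift_trdeg_add_eq K (MvPolynomial (Fin d) K) B
  rw [trdeg_eq_zero (R := MvPolynomial (Fin d) K), h] at key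
  simp only [MvPolynomial.trdeg_of_isDomain, Cardinal.mk_fin, Cardinal.lift_natCast,
    Cardinal.lift_zero, add_zero, Nat.cast_inj] at key
  rw [hd, key]

lemma ringKrullDim_quotient_ker {K σ τ : Type*} [Field K] [Finite σ] [Fintype τ]
    (f : MvPolynomial σ K →ₐ[K] MvPolynomial τ K)
    (hf : ∀ v, IsAlgebraic f.range (MvPolynomial.X v : MvPolynomial τ K)) :
    ringKrullDim (MvPolynomial σ K ⧸ RingHom.ker f) = Fintype.card τ := by
  have e := (Ideal.quotientKerEquivRange f)
  rw [ringKrullDim_eq_of_ringEquiv e.toRingEquiv]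
  have : Algebra.FiniteType K f.range :=
    Algebra.FiniteType.of_surjective f.rangeRestrict f.rangeRestrict_surjective
  apply ringKrullDim_eq_of_trdeg (K := K)
  have halg : Algebra.IsAlgebraic f.range (MvPolynomial τ K) := by
    refine ⟨fun p => ?_⟩
    induction p using MvPolynomial.induction_on with
    | C a => exact isAlgebraic_algebraMap (algebraMap K f.range a)
    | add p q hp hq => exact hp.add hq
    | mul_X p v hp => exact hp.mul (hf v)
  have key := trdeg_add_eq K f.range (A := MvPolynomial τ K)
  rw [trdeg_eq_zero (R := f.range), add_zero] at key
  simpa using key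

/-! ### Edge vectors of the glued odd cycles -/

lemma cycleVertex_injective {s : ℕ} (t : Fin s → ℕ) (i : Fin s) :
    Function.Injective (cycleVertex t i) := by
  intro j k
  refine Fin.cases ?_ (fun j => ?_) j <;> refine Fin.cases ?_ (fun k => ?_) k <;>
    simp [cycleVertex]

/-- The exponent vector of the image of the `j`-th edge of the `i`-th cycle, which joins the
vertices `j` and `j + 1` of that cycle. -/
noncomputable def edgeVector {s : ℕ} (t : Fin s → ℕ) (e : Σ i : Fin s, Fin (2 * t i + 1)) :
    Option (Σ i : Fin s, Fin (2 * t i)) →₀ ℕ :=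
  Finsupp.single (cycleVertex t e.1 e.2) 1 + Finsupp.single (cycleVertex t e.1 (e.2 + 1)) 1

lemma linearCombination_edgeVector {s : ℕ} (t : Fin s → ℕ)
    (m : (Σ i : Fin s, Fin (2 * t i + 1)) →₀ ℕ) :
    Finsupp.linearCombination ℕ (edgeVector t) m =
      ∑ i, (Finsupp.single none (m ⟨i, 0⟩ + m ⟨i, Fin.last _⟩) +
        ∑ k : Fin (2 * t i), Finsupp.single (some ⟨i, k⟩) (m ⟨i, k.succ⟩ + m ⟨i, k.castSucc⟩)) := by
  rw [Finsupp.linearCombination_apply, Finsupp.sum_fintype _ _ (by simp), Fintype.sum_sigma]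
  refine Finset.sum_congr rfl fun i _ => ?_
  simp only [edgeVector, smul_add, Finsupp.smul_single, smul_eq_mul, mul_one,
    Finset.sum_add_distrib]
  -- Regrouped by vertex: vertex `j` lies on edges `j` and `j - 1`, and for `j = 0` the latter wraps
  -- around to the last edge.
  have h : ∑ j, Finsupp.single (cycleVertex t i (j + 1)) (m ⟨i, j⟩) =
      ∑ j, Finsupp.single (cycleVertex t i j) (m ⟨i, j - 1⟩) := by
    rw [← Equiv.sum_comp (Equiv.addRight 1)
      (fun j => Finsupp.single (cycleVertex t i j) (m ⟨i, j - 1⟩))]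
    simp
  have h0 : (0 : Fin (2 * t i + 1)) - 1 = Fin.last _ := by
    rw [sub_eq_iff_eq_add, Fin.last_add_one]
  have hs : ∀ k : Fin (2 * t i), k.succ - 1 = k.castSucc := fun k => by
    rw [sub_eq_iff_eq_add, Fin.coeSucc_eq_succ]
  rw [h, ← Finset.sum_add_distrib, Fin.sum_univ_succ]
  simp only [← Finsupp.single_add, h0, hs]
  rfl

lemma linearCombination_edgeVector_some {s : ℕ} (t : Fin s → ℕ)
    (m : (Σ i : Fin s, Fin (2 * t i + 1)) →₀ ℕ) (i : Fin s) (k : Fin (2 * t i)) :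
    Finsupp.linearCombination ℕ (edgeVector t) m (some ⟨i, k⟩) =
      m ⟨i, k.succ⟩ + m ⟨i, k.castSucc⟩ := by
  rw [linearCombination_edgeVector]
  simp only [Finsupp.finsetSum_apply, Finsupp.add_apply]
  rw [Finset.sum_eq_single i, Finset.sum_eq_single k]
  · simp
  · intro l _ hl
    simp [hl]
  · simp
  · intro j _ hj
    simp [hj]
  · simp

lemma linearCombination_edgeVector_none {s : ℕ} (t : Fin s → ℕ)
    (m : (Σ i : Fin s, Fin (2 * t i + 1)) →₀ ℕ) :
    Finsupp.linearCombination ℕ (edgeVector t) m none =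
      ∑ i, (m ⟨i, 0⟩ + m ⟨i, Fin.last _⟩) := by
  rw [linearCombination_edgeVector]
  simp [Finsupp.finsetSum_apply]

/-- Two edge exponent vectors whose images differ by a multiple of the common vertex differ by an
alternating vector on every cycle. -/
lemma alternating_of_linearCombination_eq {s : ℕ} {t : Fin s → ℕ}
    {m m' : (Σ i : Fin s, Fin (2 * t i + 1)) →₀ ℕ} {k : ℕ}
    (h : Finsupp.linearCombination ℕ (edgeVector t) m =
      Finsupp.linearCombination ℕ (edgeVector t) m' + Finsupp.single none (2 * k)) :
    (∀ i j, (m ⟨i, j⟩ : ℤ) - m' ⟨i, j⟩ = (-1) ^ (j : ℕ) * (m ⟨i, 0⟩ - m' ⟨i, 0⟩)) ∧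
      ∑ i, ((m ⟨i, 0⟩ : ℤ) - m' ⟨i, 0⟩) = k := by
  have h1 : ∀ i j, (m ⟨i, j⟩ : ℤ) - m' ⟨i, j⟩ = (-1) ^ (j : ℕ) * (m ⟨i, 0⟩ - m' ⟨i, 0⟩) := by
    intro i j
    induction j using Fin.induction with
    | zero => simp
    | succ j ih =>
      have hj := DFunLike.congr_fun h (some ⟨i, j⟩)
      simp only [Finsupp.add_apply, linearCombination_edgeVector_some] at hj
      rw [Finsupp.single_eq_of_ne (by simp), add_zero] at hj
      zify at hj
      rw [Fin.val_castSucc] at ih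
      rw [Fin.val_succ, pow_succ]
      linear_combination hj - ih
  refine ⟨h1, ?_⟩
  have h0 := DFunLike.congr_fun h none
  simp only [Finsupp.add_apply, linearCombination_edgeVector_none, Finsupp.single_eq_same] at h0
  zify at h0
  have h2 : ∑ i, ((m ⟨i, 0⟩ : ℤ) + m ⟨i, Fin.last _⟩) - ∑ i, ((m' ⟨i, 0⟩ : ℤ) + m' ⟨i, Fin.last _⟩) =
      2 * ∑ i, ((m ⟨i, 0⟩ : ℤ) - m' ⟨i, 0⟩) := by
    rw [← Finset.sum_sub_distrib, Finset.mul_sum]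
    refine Finset.sum_congr rfl fun i _ => ?_
    -- The last edge has even index `2 * t i`, so it carries the same sign as edge `0`; this is
    -- where odd cycle length enters.
    have := h1 i (Fin.last _)
    rw [Fin.val_last, pow_mul, neg_one_sq, one_pow, one_mul] at this
    linear_combination this
  linarith

/-- The edges of the `i`-th cycle at even positions. -/
def evenEdges {s : ℕ} (t : Fin s → ℕ) (i : Fin s) : Finset (Σ i : Fin s, Fin (2 * t i + 1)) :=
  Finset.univ.filter fun e => e.1 = i ∧ Even (e.2 : ℕ)

/-- The edges of the `i`-th cycle at odd positions. -/
def oddEdges {s : ℕ} (t : Fin s → ℕ) (i : Fin s) : Finset (Σ i : Fin s, Fin (2 * t i + 1)) :=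
  Finset.univ.filter fun e => e.1 = i ∧ ¬ Even (e.2 : ℕ)

lemma card_evenEdges {s : ℕ} (t : Fin s → ℕ) (i : Fin s) : (evenEdges t i).card = t i + 1 := by
  have : evenEdges t i = Finset.univ.image
      (fun a : Fin (t i + 1) => (⟨i, ⟨2 * a, by omega⟩⟩ : Σ i : Fin s, Fin (2 * t i + 1))) := by
    ext ⟨l, j⟩
    simp only [evenEdges, Finset.mem_filter, Finset.mem_univ, true_and, Finset.mem_image]
    constructor
    · rintro ⟨rfl, a, ha⟩
      refine ⟨⟨a, by omega⟩, ?_⟩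
      simp only [Sigma.mk.injEq, heq_eq_eq, true_and, Fin.ext_iff]
      omega
    · rintro ⟨a, h⟩
      cases h
      simp
  rw [this, Finset.card_image_of_injective, Finset.card_univ, Fintype.card_fin]
  intro a b hab
  simp only [Sigma.mk.injEq, heq_eq_eq, true_and, Fin.mk.injEq] at hab
  omega

lemma card_oddEdges {s : ℕ} (t : Fin s → ℕ) (i : Fin s) : (oddEdges t i).card = t i := by
  have : oddEdges t i = Finset.univ.image
      (fun a : Fin (t i) => (⟨i, ⟨2 * a + 1, by omega⟩⟩ : Σ i : Fin s, Fin (2 * t i + 1))) := by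
    ext ⟨l, j⟩
    simp only [oddEdges, Finset.mem_filter, Finset.mem_univ, true_and, Finset.mem_image]
    constructor
    · rintro ⟨rfl, h⟩
      obtain ⟨a, ha⟩ := Nat.not_even_iff_odd.1 h
      refine ⟨⟨a, by omega⟩, ?_⟩
      simp only [Sigma.mk.injEq, heq_eq_eq, true_and, Fin.ext_iff]
      omega
    · rintro ⟨a, h⟩
      cases h
      simp
  rw [this, Finset.card_image_of_injective, Finset.card_univ, Fintype.card_fin]
  intro a b hab
  simp only [Sigma.mk.injEq, heq_eq_eq, true_and, Fin.mk.injEq] at hab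
  omega

/-- Even edges cover each vertex of the cycle once, but the common vertex twice, by the first and
last edges. Odd edges cover each of the other vertices once. -/
lemma linearCombination_evenEdges {s : ℕ} (t : Fin s → ℕ) (i : Fin s) :
    Finsupp.linearCombination ℕ (edgeVector t) (indicatorVector (evenEdges t i)) =
      Finsupp.linearCombination ℕ (edgeVector t) (indicatorVector (oddEdges t i)) +
        Finsupp.single none 2 := by
  classical
  ext v
  rw [Finsupp.add_apply]
  cases v with
  | none =>
    simp only [linearCombination_edgeVector_none, indicatorVector_apply, evenEdges, oddEdges,
      Finset.mem_filter, Finset.mem_univ, true_and, Fin.val_zero, Fin.val_last, Even.zero,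
      even_two_mul, not_true, and_true, and_false, if_false, Finsupp.single_eq_same]
    simp [Finset.sum_add_distrib]
  | some v =>
    obtain ⟨l, k⟩ := v
    simp only [linearCombination_edgeVector_some, indicatorVector_apply, evenEdges, oddEdges,
      Finset.mem_filter, Finset.mem_univ, true_and, Fin.val_succ, Fin.val_castSucc,
      Nat.even_add_one, not_not]
    rw [Finsupp.single_eq_of_ne (by simp), add_zero, add_comm]

lemma pairwise_disjoint_evenEdges {s : ℕ} (t : Fin s → ℕ) :
    Pairwise fun i j => Disjoint (evenEdges t i) (evenEdges t j) := by
  intro i j hij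
  rw [Finset.disjoint_left]
  intro e he he'
  simp only [evenEdges, Finset.mem_filter] at he he'
  exact hij (he.2.1.symm.trans he'.2.1)

lemma pairwise_disjoint_oddEdges {s : ℕ} (t : Fin s → ℕ) :
    Pairwise fun i j => Disjoint (oddEdges t i) (oddEdges t j) := by
  intro i j hij
  rw [Finset.disjoint_left]
  intro e he he'
  simp only [oddEdges, Finset.mem_filter] at he he'
  exact hij (he.2.1.symm.trans he'.2.1)

/-- If an alternating difference is positive at the start of a cycle, the larger vector contains the
even edges and the smaller one contains the odd edges of that cycle. -/
lemma le_of_alternating_pos {s : ℕ} {t : Fin s → ℕ}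
    {m m' : (Σ i : Fin s, Fin (2 * t i + 1)) →₀ ℕ}
    (h : ∀ i j, (m ⟨i, j⟩ : ℤ) - m' ⟨i, j⟩ = (-1) ^ (j : ℕ) * (m ⟨i, 0⟩ - m' ⟨i, 0⟩))
    {i : Fin s} (hi : 0 < (m ⟨i, 0⟩ : ℤ) - m' ⟨i, 0⟩) :
    indicatorVector (evenEdges t i) ≤ m ∧ indicatorVector (oddEdges t i) ≤ m' := by
  simp only [indicatorVector_le_iff, evenEdges, oddEdges, Finset.mem_filter, Finset.mem_univ,
    true_and]
  constructor
  · rintro ⟨l, j⟩ ⟨rfl, hj⟩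
    have := h l j
    rw [hj.neg_one_pow, one_mul] at this
    dsimp only at hi
    omega
  · rintro ⟨l, j⟩ ⟨rfl, hj⟩
    have := h l j
    dsimp only at hi
    rw [(Nat.not_even_iff_odd.1 hj).neg_one_pow] at this
    omega

/-- The alternating coefficients sum to zero and do not all vanish, so one is positive. -/
lemma exists_le_of_linearCombination_eq {s : ℕ} {t : Fin s → ℕ}
    {m m' : (Σ i : Fin s, Fin (2 * t i + 1)) →₀ ℕ}
    (h : Finsupp.linearCombination ℕ (edgeVector t) m =
      Finsupp.linearCombination ℕ (edgeVector t) m') (hne : m ≠ m') :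
    ∃ i, indicatorVector (evenEdges t i) ≤ m ∧ indicatorVector (oddEdges t i) ≤ m' := by
  obtain ⟨h1, h2⟩ := alternating_of_linearCombination_eq (k := 0) (by simpa using h)
  obtain ⟨i, -, hi⟩ := Finset.exists_pos_of_sum_zero_of_exists_nonzero
    (s := Finset.univ) (fun i => (m ⟨i, 0⟩ : ℤ) - m' ⟨i, 0⟩) h2 (by
    by_contra! h0
    refine hne (Finsupp.ext fun ⟨i, j⟩ => ?_)
    have := h1 i j
    rw [h0 i (Finset.mem_univ _), mul_zero] at this
    omega)
  exact ⟨i, le_of_alternating_pos h1 hi⟩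

/-- Here the alternating coefficients sum to `1`, so again one is positive. -/
lemma exists_le_of_linearCombination_eq_add {s : ℕ} {t : Fin s → ℕ}
    {m m' : (Σ i : Fin s, Fin (2 * t i + 1)) →₀ ℕ}
    (h : Finsupp.linearCombination ℕ (edgeVector t) m =
      Finsupp.linearCombination ℕ (edgeVector t) m' + Finsupp.single none 2) :
    ∃ i, indicatorVector (evenEdges t i) ≤ m ∧ indicatorVector (oddEdges t i) ≤ m' := by
  obtain ⟨h1, h2⟩ := alternating_of_linearCombination_eq (k := 1) (by simpa using h)
  obtain ⟨i, -, hi⟩ := Finset.exists_lt_of_sum_lt (s := Finset.univ) (f := fun _ => (0 : ℤ))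
    (g := fun i => (m ⟨i, 0⟩ : ℤ) - m' ⟨i, 0⟩) (by rw [h2]; simp)
  exact ⟨i, le_of_alternating_pos h1 hi⟩

lemma mk_ncard_edgeVector_mul {s : ℕ} (t : Fin s → ℕ) :
    PowerSeries.mk (fun n => ((Finsupp.linearCombination ℕ (edgeVector t) ''
      {m | m.degree = n}).ncard : ℤ)) * (1 - PowerSeries.X) =
      degreeSeries (Set.univ : Set ((Σ i : Fin s, Fin (2 * t i + 1)) →₀ ℕ)) *
        (∏ i, (1 - PowerSeries.X ^ (t i + 1)) - PowerSeries.X * ∏ i, (1 - PowerSeries.X ^ t i)) := by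
  have h := mk_ncard_image_mul_one_sub_X
    (Finsupp.linearCombination ℕ (edgeVector t)).toAddMonoidHom (Finsupp.single none 2)
    (evenEdges t) (oddEdges t) (fun i => by rw [card_evenEdges, card_oddEdges])
    (linearCombination_evenEdges t)
    (fun m m' h hne => (exists_le_of_linearCombination_eq h hne).imp fun _ => And.left)
    (fun m m' h hne => (exists_le_of_linearCombination_eq h.symm hne.symm).imp fun _ => And.right)
    (fun m m' h => by
      obtain ⟨i, hi, hi'⟩ := exists_le_of_linearCombination_eq_add h
      exact ⟨⟨i, hi⟩, i, hi'⟩)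
  rw [degreeSeries_avoiding (pairwise_disjoint_evenEdges t),
    degreeSeries_avoiding (pairwise_disjoint_oddEdges t)] at h
  simp only [card_evenEdges, card_oddEdges] at h
  refine h.trans ?_
  ring

/-! ### Passage from cycle positions to the graph and its toric ring -/

lemma oddCycleGraph_adj {s : ℕ} (t : Fin s → ℕ) (ht : ∀ i, 1 ≤ t i) (v w) :
    (oddCycleGraph t).Adj v w ↔ ∃ i j, s(cycleVertex t i j, cycleVertex t i (j + 1)) = s(v, w) := by
  have key : ∀ i, ∀ a b : Fin (2 * t i + 1),
      (SimpleGraph.cycleGraph (2 * t i + 1)).Adj a b ↔ a = b + 1 ∨ b = a + 1 := by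
    intro i a b
    -- This needs `t i ≥ 1`: in `Fin 1` the element `1` is `0`.
    have h1 : ((1 : Fin (2 * t i + 1)) : ℕ) = 1 := by
      rw [Fin.val_one', Nat.mod_eq_of_lt (by have := ht i; omega)]
    have h2 : ∀ x : Fin (2 * t i + 1), (x : ℕ) = 1 ↔ x = 1 := fun x => by rw [Fin.ext_iff, h1]
    rw [SimpleGraph.cycleGraph_adj', h2, h2, sub_eq_iff_eq_add', sub_eq_iff_eq_add']
  have hadj : (oddCycleGraph t).Adj v w ↔ ∃ i, ∃ a b : Fin (2 * t i + 1),
      (a = b + 1 ∨ b = a + 1) ∧ cycleVertex t i a = v ∧ cycleVertex t i b = w := by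
    rw [oddCycleGraph, SimpleGraph.iSup_adj]
    refine exists_congr fun i => ?_
    have := SimpleGraph.map_adj ⟨cycleVertex t i, cycleVertex_injective t i⟩
      (SimpleGraph.cycleGraph (2 * t i + 1)) v w
    simp only [key] at this
    exact this
  rw [hadj]
  constructor
  · rintro ⟨i, a, b, rfl | rfl, rfl, rfl⟩
    · exact ⟨i, b, Sym2.eq_swap⟩
    · exact ⟨i, a, rfl⟩
  · rintro ⟨i, j, h⟩
    rcases Sym2.eq_iff.1 h with ⟨rfl, rfl⟩ | ⟨rfl, rfl⟩
    · exact ⟨i, j, j + 1, Or.inr rfl, rfl, rfl⟩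
    · exact ⟨i, j + 1, j, Or.inl rfl, rfl, rfl⟩

/-- The `j`-th edge of the `i`-th cycle of `G(t_1, …, t_s)`. -/
def cycleEdge {s : ℕ} (t : Fin s → ℕ) (ht : ∀ i, 1 ≤ t i) (e : Σ i : Fin s, Fin (2 * t i + 1)) :
    (oddCycleGraph t).edgeSet :=
  ⟨s(cycleVertex t e.1 e.2, cycleVertex t e.1 (e.2 + 1)),
    (oddCycleGraph_adj t ht _ _).2 ⟨e.1, e.2, rfl⟩⟩

lemma cycleEdge_surjective {s : ℕ} (t : Fin s → ℕ) (ht : ∀ i, 1 ≤ t i) :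
    Function.Surjective (cycleEdge t ht) := by
  rintro ⟨e, he⟩
  induction e using Sym2.ind with
  | h v w =>
    obtain ⟨i, j, h⟩ := (oddCycleGraph_adj t ht v w).1 he
    exact ⟨⟨i, j⟩, Subtype.ext h⟩

lemma edgeMap_comp_rename_cycleEdge (K : Type*) [Field K] {s : ℕ} (t : Fin s → ℕ)
    (ht : ∀ i, 1 ≤ t i) :
    (edgeMap K (oddCycleGraph t)).comp (MvPolynomial.rename (cycleEdge t ht)) =
      MvPolynomial.aeval fun e => MvPolynomial.monomial (edgeVector t e) (1 : K) := by
  ext1 e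
  rw [AlgHom.comp_apply, MvPolynomial.rename_X, edgeMap, MvPolynomial.aeval_X,
    MvPolynomial.aeval_X, edgeVector, ← one_mul (1 : K), ← MvPolynomial.monomial_mul]
  rfl

lemma edgeMap_isHomogeneous (K : Type*) [Field K] {V : Type*} (G : SimpleGraph V) (n : ℕ)
    (p : MvPolynomial G.edgeSet K) (hp : p.IsHomogeneous n) :
    (edgeMap K G p).IsHomogeneous (2 * n) := by
  refine hp.aeval _ fun e => ?_
  obtain ⟨e, he⟩ := e
  induction e using Sym2.ind with
  | h v w => exact (MvPolynomial.isHomogeneous_X K v).mul (MvPolynomial.isHomogeneous_X K w)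

lemma hilbertSeries_toricIdeal_oddCycleGraph (K : Type*) [Field K] {s : ℕ} (t : Fin s → ℕ)
    (ht : ∀ i, 1 ≤ t i) :
    hilbertSeries (toricIdeal K (oddCycleGraph t)) =
      PowerSeries.mk fun n => ((Finsupp.linearCombination ℕ (edgeVector t) ''
        {m | m.degree = n}).ncard : ℤ) := by
  ext n
  rw [hilbertSeries, PowerSeries.coeff_mk, PowerSeries.coeff_mk, toricIdeal,
    finrank_quotientPiece_ker, ← map_rename_homogeneousSubmodule (cycleEdge_surjective t ht),
    ← Submodule.map_comp, ← AlgHom.comp_toLinearMap, edgeMap_comp_rename_cycleEdge,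
    finrank_map_aeval_monomial]

lemma monomial_mem_range_edgeMap (K : Type*) [Field K] {s : ℕ} (t : Fin s → ℕ)
    (ht : ∀ i, 1 ≤ t i) (m : (Σ i : Fin s, Fin (2 * t i + 1)) →₀ ℕ) :
    MvPolynomial.monomial (Finsupp.linearCombination ℕ (edgeVector t) m) (1 : K) ∈
      (edgeMap K (oddCycleGraph t)).range := by
  rw [← aeval_monomial_monomial, ← edgeMap_comp_rename_cycleEdge K t ht]
  exact ⟨_, rfl⟩

/-- The square of the common variable is a quotient of two monomials of the edge ring, those of the
even and the odd edges of one cycle. Algebraicity then spreads along each cycle, since `x_j *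
x_(j+1)` lies in the ring. -/
lemma isAlgebraic_X_range_edgeMap (K : Type*) [Field K] {s : ℕ} (hs : 1 ≤ s) (t : Fin s → ℕ)
    (ht : ∀ i, 1 ≤ t i) (v : Option (Σ i : Fin s, Fin (2 * t i))) :
    IsAlgebraic (edgeMap K (oddCycleGraph t)).range (MvPolynomial.X v : MvPolynomial _ K) := by
  have hmem : ∀ p ∈ (edgeMap K (oddCycleGraph t)).range,
      IsAlgebraic (edgeMap K (oddCycleGraph t)).range p := fun p hp =>
    isAlgebraic_algebraMap (⟨p, hp⟩ : (edgeMap K (oddCycleGraph t)).range)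
  have hnone : IsAlgebraic (edgeMap K (oddCycleGraph t)).range
      (MvPolynomial.X none : MvPolynomial (Option (Σ i : Fin s, Fin (2 * t i))) K) := by
    refine IsAlgebraic.of_pow (n := 2) two_pos ?_
    have h := monomial_mem_range_edgeMap K t ht (indicatorVector (evenEdges t ⟨0, hs⟩))
    rw [linearCombination_evenEdges, ← one_mul (1 : K), ← MvPolynomial.monomial_mul] at h
    rw [MvPolynomial.X_pow_eq_monomial]
    exact IsAlgebraic.of_mul (mem_nonZeroDivisors_of_ne_zero (by simp))
      (hmem _ (monomial_mem_range_edgeMap K t ht _)) (hmem _ h)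
  have hcycle : ∀ i j, IsAlgebraic (edgeMap K (oddCycleGraph t)).range
      (MvPolynomial.X (cycleVertex t i j) : MvPolynomial _ K) := by
    intro i j
    induction j using Fin.induction with
    | zero => exact hnone
    | succ j ih =>
      refine IsAlgebraic.of_mul (mem_nonZeroDivisors_of_ne_zero (MvPolynomial.X_ne_zero _)) ih
        (hmem _ ?_)
      have h := monomial_mem_range_edgeMap K t ht (Finsupp.single ⟨i, j.castSucc⟩ 1)
      rw [Finsupp.linearCombination_single, one_smul, edgeVector, ← one_mul (1 : K),
        ← MvPolynomial.monomial_mul, Fin.coeSucc_eq_succ] at h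
      exact h
  cases v with
  | none => exact hnone
  | some v => exact hcycle v.1 v.2.succ

lemma ringKrullDim_toricIdeal_oddCycleGraph (K : Type*) [Field K] {s : ℕ} (hs : 1 ≤ s)
    (t : Fin s → ℕ) (ht : ∀ i, 1 ≤ t i) :
    ringKrullDim (MvPolynomial (oddCycleGraph t).edgeSet K ⧸ toricIdeal K (oddCycleGraph t)) =
      (∑ i, 2 * t i + 1 : ℕ) := by
  rw [toricIdeal, ringKrullDim_quotient_ker _ (isAlgebraic_X_range_edgeMap K hs t ht)]
  simp

lemma hilbertSeries_toricIdeal_mul (K : Type*) [Field K] {s : ℕ} (t : Fin s → ℕ)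
    (ht : ∀ i, 1 ≤ t i) :
    hilbertSeries (toricIdeal K (oddCycleGraph t)) *
        (1 - PowerSeries.X) ^ (∑ i, 2 * t i + 1) =
      ∏ i, ∑ j ∈ Finset.range (t i + 1), (PowerSeries.X : PowerSeries ℤ) ^ j -
        PowerSeries.X * ∏ i, ∑ j ∈ Finset.range (t i), (PowerSeries.X : PowerSeries ℤ) ^ j := by
  have hne : (1 - PowerSeries.X : PowerSeries ℤ) ≠ 0 := fun h => by
    have := congrArg (PowerSeries.coeff 0) h
    simp at this
  refine mul_right_cancel₀ (pow_ne_zero s hne) ?_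
  have hprod : ∀ a : Fin s → ℕ,
      (∏ i, ∑ j ∈ Finset.range (a i), (PowerSeries.X : PowerSeries ℤ) ^ j) *
        (1 - PowerSeries.X) ^ s = ∏ i, (1 - PowerSeries.X ^ a i) := by
    intro a
    simp_rw [← geom_sum_mul_neg]
    rw [Finset.prod_mul_distrib, Finset.prod_const, Finset.card_univ, Fintype.card_fin]
  rw [sub_mul, mul_assoc PowerSeries.X, hprod, hprod, mul_assoc, ← pow_add,
    hilbertSeries_toricIdeal_oddCycleGraph K t ht]
  -- This is `|V| + s = 1 + |E|`: the extra factor `1 - X` feeds the counting identity, and the rest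
  -- cancels the series of all edge vectors.
  have hcard : ∑ i, 2 * t i + 1 + s = 1 + Fintype.card (Σ i : Fin s, Fin (2 * t i + 1)) := by
    simp [Finset.sum_add_distrib]
    ring
  rw [hcard, pow_add, pow_one, ← mul_assoc, mk_ncard_edgeVector_mul, mul_right_comm,
    degreeSeries_univ_mul, one_mul]

theorem corollary1p2 (K : Type*) [Field K] (s : ℕ) (hs : 1 ≤ s)
    (t : Fin s → ℕ) (ht : ∀ i, 1 ≤ t i) :
    IsHPolynomial (toricIdeal K (oddCycleGraph t))
      ((∏ i : Fin s, ∑ j ∈ Finset.range (t i + 1), (Polynomial.X : Polynomial ℤ) ^ j) -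
        Polynomial.X *
          ∏ i : Fin s, ∑ j ∈ Finset.range (t i), (Polynomial.X : Polynomial ℤ) ^ j) := by
  refine ⟨isHomogeneous_ker _ two_ne_zero (edgeMap_isHomogeneous K _), ?_, _,
    ringKrullDim_toricIdeal_oddCycleGraph K hs t ht, ?_⟩
  · have : NeZero s := ⟨by omega⟩
    -- The value at `1` is `∏ (t i + 1) - ∏ t i`, positive because there is at least one cycle.
    have hlt : ∏ i, (t i : ℤ) < ∏ i, ((t i : ℤ) + 1) :=
      Finset.prod_lt_prod_of_nonempty (fun i _ => by exact_mod_cast ht i) (fun i _ => by omega)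
        Finset.univ_nonempty
    simp only [Polynomial.eval_sub, Polynomial.eval_mul, Polynomial.eval_prod,
      Polynomial.eval_finsetSum, Polynomial.eval_pow, Polynomial.eval_X, one_pow,
      Finset.sum_const, Finset.card_range, nsmul_eq_mul, mul_one, one_mul, Nat.cast_add,
      Nat.cast_one]
    omega
  · rw [hilbertSeries_toricIdeal_mul K t ht, ← Polynomial.coeToPowerSeries.ringHom_apply]
    simp only [map_sub, map_mul, map_prod, map_sum, map_pow,
      Polynomial.coeToPowerSeries.ringHom_apply, Polynomial.coe_X]
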